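/- Let $n\ge 1$ and $s\ge 0$ be integers. Put $q_n=x_1^2+\cdots+x_n^2\in\mathbb{C}[x_1,\dots,x_n]$ and $T_{n,s}=\binom{s+n-1}{s}$. For $\mathbf{a},\mathbf{b}\in\mathbb{C}^n$ write $\mathbf{a}\cdot\mathbf{b}=\sum_i a_ib_i$ (the bilinear, not the Hermitian, product) and $\mathbf{a}\cdot\mathbf{x}=\sum_i a_ix_i$. A point $\mathbf{a}\in\mathbb{C}^n$ is called isotropic if $\mathbf{a}\cdot\mathbf{a}=0$. A decomposition of $q_n^s$ of size $m$ is a family of points $\mathbf{a}_1,\dots,\mathbf{a}_m\in\mathbb{C}^n$ with \[ q_n^s=\sum_{k=1}^{m}(\mathbf{a}_k\cdot\mathbf{x})^{2s} \] in $\mathbb{C}[x_1,\dots,x_n]$. It is called tight if $m=T_{n,s}$; it is called $r$-th caliber if $(\mathbf{a}_k\cdot\mathbf{a}_k)^s$ takes exactly $r$ values for $k=1,\dots,m$, and first caliber if this holds with $r=1$. Then every tight decomposition $q_n^s=\sum_{k=1}^{T_{n,s}}(\mathbf{a}_k\cdot\mathbf{x})^{2s}$ is first caliber and, more precisely, \[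 (\mathbf{a}_k\cdot\mathbf{a}_k)^s=\frac{1}{T_{n,s}}\prod_{j=0}^{s-1}\frac{2j+n}{2j+1}\qquad\text{for every } k=1,\dots,T_{n,s}. \] If moreover $s\ge 1$, then none of the points $\mathbf{a}_k$ is isotropic. -/

import Mathlib

open MvPolynomial

namespace TightDecomposition

/-- The quadratic form `q_n = x_1^2 + ... + x_n^2` as a complex polynomial in `n` variables. -/
noncomputable def q (n : ℕ) : MvPolynomial (Fin n) ℂ :=
  ∑ i, X i ^ 2

/-- The linear form `a · x = a_1 x_1 + ... + a_n x_n` attached to the point `a` of `ℂ^n`. -/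
noncomputable def linForm {n : ℕ} (a : Fin n → ℂ) : MvPolynomial (Fin n) ℂ :=
  ∑ i, C (a i) * X i

/-- The size `T_{n,s} = binom(s+n-1, s)`, used for `n ≥ 1`. -/
def T (n s : ℕ) : ℕ :=
  (s + n - 1).choose s

/-- A point `a` of `ℂ^n` is isotropic if `a · a = 0`, for the bilinear (not Hermitian)
product `a · b = a_1 b_1 + ... + a_n b_n`. With this convention the origin is isotropic. -/
def IsIsotropic {n : ℕ} (a : Fin n → ℂ) : Prop :=
  a ⬝ᵥ a = 0

/-- The points `a_1, ..., a_m` of `ℂ^n` give a decomposition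
`q_n^s = (a_1 · x)^{2s} + ... + (a_m · x)^{2s}` of size `m`. -/
def IsDecomposition {n m : ℕ} (s : ℕ) (a : Fin m → Fin n → ℂ) : Prop :=
  q n ^ s = ∑ k, linForm (a k) ^ (2 * s)

/-- A decomposition of `q_n^s` is tight if its size is `T_{n,s}`. -/
def IsTight {n m : ℕ} (s : ℕ) (a : Fin m → Fin n → ℂ) : Prop :=
  IsDecomposition s a ∧ m = T n s

/-- A decomposition of `q_n^s` is `r`-th caliber if exactly `r` values are assumed by
`(a_k · a_k)^s`, for `k = 1, ..., m`. -/
def IsCaliber {n m : ℕ} (r s : ℕ) (a : Fin m → Fin n → ℂ) : Prop :=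
  IsDecomposition s a ∧ (Set.range fun k => (a k ⬝ᵥ a k) ^ s).ncard = r

/-- A first caliber decomposition of `q_n^s`. -/
def IsFirstCaliber {n m : ℕ} (s : ℕ) (a : Fin m → Fin n → ℂ) : Prop :=
  IsCaliber 1 s a

end TightDecomposition

namespace TightDecomposition

/-! Let `L f = ∑ k, f(a_k)` on forms of degree `2s`. Up to a scalar it is `f(∂)` applied to `q_n^s`,
so it is invariant under rotations (`sum_eval_rotation`). Forms of degree `s` act faithfully on
`q_n^s` by differentiation (`eq_zero_of_polar_eq_zero`), so a form of degree `s` vanishing at every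
`a_k` is zero. For a tight decomposition, counting dimensions then gives forms `f_k` of degree `s`
with `f_k(a_l) = δ_kl`.

These form an orthonormal basis for the invariant pairing `L(fg)`. Infinitesimal rotations therefore
have antisymmetric matrices in this basis and kill `∑ k, f_k ^ 2`, which must equal `c * q_n^s`.
Evaluating at `a_k` gives `1 = c (a_k · a_k)^s`. The common value follows from the sum of the `(a_k
· a_k)^s`, found by applying the Laplacian `s` times to the decomposition. -/

theorem C_two {σ : Type*} : (C 2 : MvPolynomial σ ℂ) = 2 :=
  map_ofNat C 2

/-! ### Graded structure of the polynomial ring -/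

section Graded

variable {σ : Type*}

attribute [local instance] MvPolynomial.gradedAlgebra

/-- A homogeneous polynomial divisible by a nonzero homogeneous polynomial has a
homogeneous quotient. -/
theorem isHomogeneous_of_mul {p g : MvPolynomial σ ℂ} {a b : ℕ} (hp : p.IsHomogeneous a)
    (hp0 : p ≠ 0) (h : (p * g).IsHomogeneous (a + b)) : g.IsHomogeneous b := by
  have key := DirectSum.coe_decompose_mul_add_of_left_mem (homogeneousSubmodule σ ℂ)
    (i := a) (j := b) (b := g) (show p ∈ homogeneousSubmodule σ ℂ a from hp)
  rw [DirectSum.decompose_of_mem_same _ (show p * g ∈ homogeneousSubmodule σ ℂ (a + b) from h)]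
    at key
  rw [mul_left_cancel₀ hp0 key]
  exact (DirectSum.decompose (homogeneousSubmodule σ ℂ) g b).2

/-- A homogeneous multiple of a nonzero form of larger degree vanishes. -/
theorem eq_zero_of_isHomogeneous_mul {p g : MvPolynomial σ ℂ} {a d : ℕ} (hp : p.IsHomogeneous a)
    (hp0 : p ≠ 0) (h : (p * g).IsHomogeneous d) (hd : d < a) : g = 0 := by
  have key := DirectSum.coe_decompose_mul_of_left_mem_of_not_le (homogeneousSubmodule σ ℂ)
    (b := g) (show p ∈ homogeneousSubmodule σ ℂ a from hp) (not_le.mpr hd)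
  rw [DirectSum.decompose_of_mem_same _ (show p * g ∈ homogeneousSubmodule σ ℂ d from h)] at key
  exact (mul_eq_zero.mp key).resolve_left hp0

theorem pderiv_comm (i j : σ) (p : MvPolynomial σ ℂ) :
    pderiv i (pderiv j p) = pderiv j (pderiv i p) := by
  classical
  have h : ⁅pderiv (R := ℂ) i, pderiv (R := ℂ) j⁆ = 0 := by
    refine derivation_ext fun k => ?_
    simp only [Derivation.commutator_apply, pderiv_X, Pi.single_apply]
    split_ifs <;> simp
  have := congrArg (fun D => D p) h
  simpa [Derivation.commutator_apply, sub_eq_zero] using this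

theorem finrank_homogeneousSubmodule (n s : ℕ) :
    Module.finrank ℂ (homogeneousSubmodule (Fin n) ℂ s) = T n s := by
  have e : homogeneousSubmodule (Fin n) ℂ s =
      restrictSupport ℂ ((Finset.univ.finsuppAntidiag s : Finset (Fin n →₀ ℕ)) : Set _) := by
    rw [homogeneousSubmodule_eq_finsupp_supported]
    unfold restrictSupport
    congr 1
    ext d
    simp [Finsupp.degree_eq_sum]
  rw [e, Module.finrank_eq_nat_card_basis (basisRestrictSupport ℂ _), Nat.card_coe_set_eq,
    Set.ncard_coe_finset, Finset.card_finsuppAntidiag_nat_eq_choose, Finset.card_univ,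
    Fintype.card_fin, T, add_comm n s]

end Graded

/-- A form of positive degree is a combination of the variables, by Euler's identity. -/
theorem exists_eq_sum_X_mul {n d : ℕ} {f : MvPolynomial (Fin n) ℂ} (hf : f.IsHomogeneous (d + 1)) :
    ∃ g : Fin n → MvPolynomial (Fin n) ℂ,
      (∀ i, (g i).IsHomogeneous d) ∧ f = ∑ i, X i * g i := by
  refine ⟨fun i => C ((d + 1 : ℂ)⁻¹) * pderiv i f, fun i => (hf.pderiv).C_mul _, ?_⟩
  have h := hf.sum_X_mul_pderiv
  have h0 : (d + 1 : ℂ) ≠ 0 := by exact_mod_cast Nat.succ_ne_zero d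
  calc f = C ((d + 1 : ℂ)⁻¹) * ((d + 1) • f) := by
        rw [nsmul_eq_mul, ← mul_assoc]
        have : ((d + 1 : ℕ) : MvPolynomial (Fin n) ℂ) = C (d + 1 : ℂ) := by simp
        rw [this, ← C_mul, inv_mul_cancel₀ h0, C_1, one_mul]
    _ = _ := by
        rw [← h, Finset.mul_sum]
        exact Finset.sum_congr rfl fun i _ => by ring

/-! ### Powers of the quadratic form and infinitesimal rotations -/

theorem q_isHomogeneous (n : ℕ) : (q n).IsHomogeneous 2 :=
  IsHomogeneous.sum _ _ _ fun i _ => isHomogeneous_X_pow i 2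

theorem eval_q {n : ℕ} (a : Fin n → ℂ) : eval a (q n) = a ⬝ᵥ a := by
  simp [q, dotProduct, sq]

theorem q_ne_zero {n : ℕ} (hn : 1 ≤ n) : q n ≠ 0 := by
  intro h
  have := congrArg (eval (Pi.single ⟨0, hn⟩ 1 : Fin n → ℂ)) h
  rw [eval_q] at this
  simp at this

theorem pderiv_q {n : ℕ} (i : Fin n) : pderiv i (q n) = 2 * X i := by
  classical
  simp [q, pderiv_X, Pi.single_apply]

theorem pderiv_q_pow {n : ℕ} (i : Fin n) (N : ℕ) :
    pderiv i (q n ^ (N + 1)) = C (2 * (N + 1) : ℂ) * X i * q n ^ N := by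
  rw [pderiv_pow, pderiv_q]
  simp [C_two]
  ring

theorem laplacian_q_pow {n : ℕ} (N : ℕ) :
    ∑ i, pderiv i (pderiv i (q n ^ (N + 1))) = C (2 * (N + 1) * (2 * N + n) : ℂ) * q n ^ N := by
  have h : ∀ i : Fin n, pderiv i (pderiv i (q n ^ (N + 1))) =
      C (2 * (N + 1) : ℂ) * (q n ^ N + X i * pderiv i (q n ^ N)) := by
    intro i
    rw [pderiv_q_pow, mul_assoc, pderiv_C_mul, pderiv_mul, pderiv_X_self, one_mul]
  have hE := ((q_isHomogeneous n).pow N).sum_X_mul_pderiv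
  rw [Finset.sum_congr rfl fun i _ => h i, ← Finset.mul_sum, Finset.sum_add_distrib, hE]
  simp [C_two]
  ring

theorem pderiv_linForm {n : ℕ} (a : Fin n → ℂ) (i : Fin n) : pderiv i (linForm a) = C (a i) := by
  classical
  simp [linForm, pderiv_X, Pi.single_apply]

/-- The infinitesimal rotation in the plane of the coordinates `i` and `j`. -/
noncomputable def rotation {n : ℕ} (i j : Fin n) :
    Derivation ℂ (MvPolynomial (Fin n) ℂ) (MvPolynomial (Fin n) ℂ) :=
  (X i : MvPolynomial (Fin n) ℂ) • pderiv j - (X j : MvPolynomial (Fin n) ℂ) • pderiv i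

theorem rotation_apply {n : ℕ} (i j : Fin n) (p : MvPolynomial (Fin n) ℂ) :
    rotation i j p = X i * pderiv j p - X j * pderiv i p := rfl

theorem rotation_mul {n : ℕ} (i j : Fin n) (p r : MvPolynomial (Fin n) ℂ) :
    rotation i j (p * r) = rotation i j p * r + p * rotation i j r := by
  rw [Derivation.leibniz, smul_eq_mul, smul_eq_mul]
  ring

theorem rotation_q {n : ℕ} (i j : Fin n) : rotation i j (q n) = 0 := by
  rw [rotation_apply, pderiv_q, pderiv_q]
  ring

theorem rotation_q_pow {n : ℕ} (i j : Fin n) (N : ℕ) : rotation i j (q n ^ N) = 0 := by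
  rw [Derivation.leibniz_pow, rotation_q]
  simp

theorem rotation_C {n : ℕ} (i j : Fin n) (c : ℂ) : rotation i j (C c) = 0 := by
  simp

theorem rotation_isHomogeneous {n d : ℕ} (i j : Fin n) {f : MvPolynomial (Fin n) ℂ}
    (hf : f.IsHomogeneous d) : (rotation i j f).IsHomogeneous d := by
  cases d with
  | zero =>
    rw [← totalDegree_zero_iff_isHomogeneous, totalDegree_eq_zero_iff_eq_C] at hf
    rw [hf, rotation_C]
    exact isHomogeneous_zero _ _ _
  | succ d =>
    rw [rotation_apply, add_comm d 1]
    exact ((isHomogeneous_X ℂ i).mul hf.pderiv).sub ((isHomogeneous_X ℂ j).mul hf.pderiv)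

theorem rotation_pderiv {n : ℕ} (i j l : Fin n) (p : MvPolynomial (Fin n) ℂ) :
    rotation i j (pderiv l p) + (pderiv l (X i) * pderiv j p - pderiv l (X j) * pderiv i p) =
      pderiv l (rotation i j p) := by
  rw [rotation_apply, rotation_apply, map_sub, pderiv_mul, pderiv_mul, pderiv_comm l j,
    pderiv_comm l i]
  ring

/-- A form of even degree killed by all infinitesimal rotations is a multiple of a power of the
quadratic form. -/
theorem exists_eq_C_mul_q_pow {n : ℕ} (hn : 1 ≤ n) (N : ℕ) (F : MvPolynomial (Fin n) ℂ)
    (hF : F.IsHomogeneous (2 * N)) (hrot : ∀ i j, rotation i j F = 0) :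
    ∃ c, F = C c * q n ^ N := by
  rcases hn.lt_or_eq with hn2 | rfl
  · induction N generalizing F with
    | zero =>
      rw [mul_zero, ← totalDegree_zero_iff_isHomogeneous, totalDegree_eq_zero_iff_eq_C] at hF
      exact ⟨_, by rw [pow_zero, mul_one]; exact hF⟩
    | succ N ih =>
      have hsw : ∀ i j, X i * pderiv j F = X j * pderiv i F := fun i j =>
        sub_eq_zero.mp (hrot i j)
      have : Nontrivial (Fin n) := Fin.nontrivial_iff_two_le.mpr hn2
      -- Two variables are needed here: `X i` is prime and divides `X j * pderiv i F` for some `j ≠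
      -- i`.
      have hdvd : ∀ i, (X i : MvPolynomial (Fin n) ℂ) ∣ pderiv i F := by
        intro i
        obtain ⟨j, hj⟩ := exists_ne i
        have h : (X i : MvPolynomial (Fin n) ℂ) ∣ X j * pderiv i F := ⟨_, (hsw i j).symm⟩
        rcases (X_dvd_mul_iff).mp h with h | h
        · exact absurd (X_dvd_X.mp h).symm hj
        · exact h
      choose G hG using hdvd
      have hGG : ∀ i j, G i = G j := by
        intro i j
        have h := hsw i j
        rw [hG i, hG j, mul_left_comm (X j)] at h
        exact (mul_left_cancel₀ (X_ne_zero j) (mul_left_cancel₀ (X_ne_zero i) h)).symm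
      have i0 : Fin n := ⟨0, hn⟩
      set H := G i0 with hH
      have hFq : (2 * (N + 1)) • F = q n * H := by
        rw [← hF.sum_X_mul_pderiv, q, Finset.sum_mul]
        refine Finset.sum_congr rfl fun i _ => ?_
        rw [hG i, hGG i i0]
        ring
      have hHh : H.IsHomogeneous (2 * N) := by
        refine isHomogeneous_of_mul (q_isHomogeneous n) (q_ne_zero hn) ?_
        rw [← hFq, show 2 + 2 * N = 2 * (N + 1) by ring]
        exact Submodule.smul_of_tower_mem (homogeneousSubmodule (Fin n) ℂ _) _ hF
      have hHr : ∀ i j, rotation i j H = 0 := by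
        intro i j
        have h := congrArg (rotation i j) hFq
        rw [map_nsmul, hrot, smul_zero, rotation_mul, rotation_q, zero_mul, zero_add] at h
        exact (mul_eq_zero.mp h.symm).resolve_left (q_ne_zero hn)
      obtain ⟨c, hc⟩ := ih H hHh hHr
      refine ⟨(2 * (N + 1) : ℂ)⁻¹ * c, ?_⟩
      have h0 : (2 * (N + 1) : ℂ) ≠ 0 := by exact_mod_cast (by omega : 2 * (N + 1) ≠ 0)
      have h1 : C (2 * (N + 1) : ℂ) * F = q n * H := by
        rw [← hFq]; simp [C_two]
      calc F = C ((2 * (N + 1) : ℂ)⁻¹) * (C (2 * (N + 1) : ℂ) * F) := by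
            rw [← mul_assoc, ← C_mul, inv_mul_cancel₀ h0, C_1, one_mul]
        _ = _ := by rw [h1, hc, C_mul, pow_succ]; ring
  -- In one variable there is no rotation to use, but every form is a multiple of a power of the
  -- variable.
  · refine ⟨coeff (Finsupp.single 0 (2 * N)) F, ?_⟩
    have hq : q 1 ^ N = monomial (Finsupp.single 0 (2 * N)) 1 := by
      rw [q, Fin.sum_univ_one, ← pow_mul, X_pow_eq_monomial]
    rw [hq, C_mul_monomial, mul_one]
    ext d
    rw [coeff_monomial]
    split_ifs with h
    · rw [h]
    · refine hF.coeff_eq_zero fun hd => h ?_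
      refine Finsupp.ext fun i => ?_
      rw [← hd, Subsingleton.elim i 0]
      simp [Finsupp.degree_eq_sum]

/-- The form `∑ k, w_k f(a_k) (a_k · x)^e / e!`, obtained by letting `f` act by differentiation on a
weighted sum of powers of linear forms. -/
noncomputable def polar {n m : ℕ} (a : Fin m → Fin n → ℂ) (w : Fin m → ℂ) (e : ℕ)
    (f : MvPolynomial (Fin n) ℂ) : MvPolynomial (Fin n) ℂ :=
  ∑ k, C (w k * eval (a k) f / (e.factorial : ℂ)) * linForm (a k) ^ e

/-! ### Forms acting by differentiation on sums of powers -/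

section Polar

variable {n m : ℕ} (a : Fin m → Fin n → ℂ) (w : Fin m → ℂ)

theorem polar_add (e : ℕ) (f g : MvPolynomial (Fin n) ℂ) :
    polar a w e (f + g) = polar a w e f + polar a w e g := by
  simp only [polar, ← Finset.sum_add_distrib]
  refine Finset.sum_congr rfl fun k _ => ?_
  rw [map_add, mul_add, add_div, C_add, add_mul]

theorem polar_C_mul (e : ℕ) (c : ℂ) (f : MvPolynomial (Fin n) ℂ) :
    polar a w e (C c * f) = C c * polar a w e f := by
  simp only [polar, Finset.mul_sum]
  refine Finset.sum_congr rfl fun k _ => ?_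
  rw [← mul_assoc, ← C_mul, map_mul, eval_C]
  congr 2
  ring

theorem polar_C (e : ℕ) (c : ℂ) :
    polar a w e (C c : MvPolynomial (Fin n) ℂ) = C c * polar a w e 1 := by
  rw [← polar_C_mul, mul_one]

theorem polar_zero (e : ℕ) : polar a w e (0 : MvPolynomial (Fin n) ℂ) = 0 := by
  simp [polar]

theorem polar_sum {ι : Type*} (t : Finset ι) (e : ℕ) (f : ι → MvPolynomial (Fin n) ℂ) :
    polar a w e (∑ i ∈ t, f i) = ∑ i ∈ t, polar a w e (f i) :=
  map_sum (AddMonoidHom.mk' (polar a w e) (polar_add a w e)) f t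

theorem polar_neg (e : ℕ) (f : MvPolynomial (Fin n) ℂ) :
    polar a w e (-f) = -polar a w e f :=
  map_neg (AddMonoidHom.mk' (polar a w e) (polar_add a w e)) f

theorem pderiv_polar (e : ℕ) (i : Fin n) (f : MvPolynomial (Fin n) ℂ) :
    pderiv i (polar a w (e + 1) f) = polar a w e (X i * f) := by
  simp only [polar, map_sum]
  refine Finset.sum_congr rfl fun k _ => ?_
  rw [pderiv_C_mul, pderiv_pow, pderiv_linForm, map_mul, eval_X, Nat.add_sub_cancel]
  have h0 : (e + 1 : ℂ) ≠ 0 := by exact_mod_cast Nat.succ_ne_zero e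
  have h1 : (e.factorial : ℂ) ≠ 0 := by exact_mod_cast e.factorial_ne_zero
  have h2 : ((e + 1 : ℕ) : MvPolynomial (Fin n) ℂ) = C (e + 1 : ℂ) := by simp
  rw [h2, mul_comm (C _ * linForm (a k) ^ e), ← mul_assoc, ← mul_assoc, ← C_mul, ← C_mul]
  congr 2
  rw [Nat.factorial_succ]
  push_cast
  field_simp

/-- The weights `w` exist to absorb factors of the quadratic form, so that inductions can pass to
the Laplacian. -/
theorem polar_q_mul (e : ℕ) (f : MvPolynomial (Fin n) ℂ) :
    polar a w e (q n * f) = polar a (fun k => w k * (a k ⬝ᵥ a k)) e f := by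
  simp only [polar, map_mul, eval_q, mul_assoc]

theorem polar_zero_right (f : MvPolynomial (Fin n) ℂ) :
    polar a w 0 f = C (∑ k, w k * eval (a k) f) := by
  simp [polar]

variable {a w}

/-- Applying the Laplacian to a representation of a power of the quadratic form. -/
theorem polar_mul_q_one {N : ℕ} {c : ℂ} (h : polar a w (2 * (N + 1)) 1 = C c * q n ^ (N + 1)) :
    polar a (fun k => w k * (a k ⬝ᵥ a k)) (2 * N) 1 =
      C (c * (2 * (N + 1) * (2 * N + n))) * q n ^ N := by
  rw [← polar_q_mul, mul_one, C_mul, mul_assoc, ← laplacian_q_pow, Finset.mul_sum]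
  conv_lhs => rw [q, polar_sum]
  refine Finset.sum_congr rfl fun i _ => ?_
  rw [← pderiv_C_mul, ← pderiv_C_mul, ← h, show 2 * (N + 1) = 2 * N + 1 + 1 by ring, pderiv_polar,
    pderiv_polar, mul_one, sq]

/-- Each Laplacian lowers `N` by one, multiplies the weights by `a_k · a_k`, and contributes one
factor of the product. -/
theorem sum_mul_dotProduct_pow {N : ℕ} {c : ℂ} (h : polar a w (2 * N) 1 = C c * q n ^ N) :
    ∑ k, w k * (a k ⬝ᵥ a k) ^ N =
      c * ∏ j ∈ Finset.range N, (2 * (j + 1) * (2 * j + n) : ℂ) := by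
  induction N generalizing w c with
  | zero =>
    rw [mul_zero, polar_zero_right, pow_zero, mul_one] at h
    simpa using C_injective _ _ h
  | succ N ih =>
    have h1 := ih (polar_mul_q_one h)
    rw [Finset.prod_range_succ]
    calc _ = ∑ k, w k * (a k ⬝ᵥ a k) * (a k ⬝ᵥ a k) ^ N :=
          Finset.sum_congr rfl fun k _ => by ring
      _ = _ := by rw [h1]; ring

/-- Modulo the quadratic form, differentiating its power by a form of low degree multiplies by a
nonzero multiple of that form. -/
theorem exists_polar_eq {N : ℕ} {c : ℂ} (hc : c ≠ 0) (h : polar a w (2 * N) 1 = C c * q n ^ N)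
    (d u : ℕ) (hdu : u + d = N) :
    ∃ c' : ℂ, c' ≠ 0 ∧ ∀ f : MvPolynomial (Fin n) ℂ, f.IsHomogeneous d →
      ∃ r, polar a w (2 * u + d) f = C c' * q n ^ u * f + q n ^ (u + 1) * r := by
  induction d generalizing u with
  | zero =>
    refine ⟨c, hc, fun f hf => ⟨0, ?_⟩⟩
    rw [← totalDegree_zero_iff_isHomogeneous, totalDegree_eq_zero_iff_eq_C] at hf
    rw [add_zero] at hdu
    rw [hf, polar_C, hdu, add_zero, h]
    ring
  | succ d ih =>
    obtain ⟨c', hc', hr⟩ := ih (u + 1) (by omega)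
    refine ⟨c' * (2 * (u + 1)), mul_ne_zero hc' (by exact_mod_cast (by positivity : 2 * (u + 1) ≠ 0)), fun f hf => ?_⟩
    obtain ⟨g, hg, rfl⟩ := exists_eq_sum_X_mul hf
    choose r hr using fun i => hr (g i) (hg i)
    -- Leibniz terms of `∂_i (c' q^(u+1) g_i + q^(u+2) r_i)` still divisible by `q^(u+1)`; the
    -- remaining term gives the new constant `2(u+1)c'`.
    refine ⟨∑ i, (C c' * pderiv i (g i) + C (2 * (u + 2) : ℂ) * X i * r i + q n * pderiv i (r i)), ?_⟩
    rw [polar_sum, Finset.mul_sum, Finset.mul_sum, ← Finset.sum_add_distrib]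
    refine Finset.sum_congr rfl fun i _ => ?_
    rw [← pderiv_polar, show 2 * u + (d + 1) + 1 = 2 * (u + 1) + d by ring, hr i, map_add,
      mul_assoc, pderiv_C_mul, pderiv_mul, pderiv_mul, pderiv_q_pow, pderiv_q_pow]
    simp only [C_mul, C_add, Nat.cast_add, Nat.cast_one]
    rw [show (C 2 : MvPolynomial (Fin n) ℂ) = C 1 + C 1 by rw [← C_add]; norm_num]
    ring

/-- Forms of degree at most `N` act faithfully on the `N`-th power of the quadratic form. -/
theorem eq_zero_of_polar_eq_zero (hn : 1 ≤ n) {N : ℕ} {c : ℂ} (hc : c ≠ 0)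
    (h : polar a w (2 * N) 1 = C c * q n ^ N) (d u : ℕ) (hdu : u + d = N)
    {f : MvPolynomial (Fin n) ℂ} (hf : f.IsHomogeneous d) (h0 : polar a w (2 * u + d) f = 0) :
    f = 0 := by
  induction d using Nat.strong_induction_on generalizing N c w u f with
  | _ d ih =>
    obtain ⟨c', hc', hr⟩ := exists_polar_eq hc h d u hdu
    obtain ⟨r, hr⟩ := hr f hf
    -- Cancelling `q^u` shows that the quadratic form divides `f`.
    have hqf : f = q n * (C (-c'⁻¹) * r) := by
      have h1 : q n ^ u * (C c' * f + q n * r) = 0 := by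
        rw [← h0, hr]; ring
      have h2 := (mul_eq_zero.mp h1).resolve_left (pow_ne_zero _ (q_ne_zero hn))
      calc f = C (c'⁻¹) * (C c' * f) := by
            rw [← mul_assoc, ← C_mul, inv_mul_cancel₀ hc', C_1, one_mul]
        _ = _ := by rw [eq_neg_of_add_eq_zero_left h2, C_neg]; ring
    generalize C (-c'⁻¹) * r = g at hqf
    subst hqf
    rcases lt_or_ge d 2 with hd | hd
    · rw [eq_zero_of_isHomogeneous_mul (q_isHomogeneous n) (q_ne_zero hn) hf hd, mul_zero]
    · obtain ⟨d, rfl⟩ := Nat.exists_eq_add_of_le hd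
      obtain ⟨N, rfl⟩ : ∃ M, N = M + 1 := ⟨N - 1, by omega⟩
      have hg := isHomogeneous_of_mul (q_isHomogeneous n) (q_ne_zero hn) hf
      have hne : c * (2 * (N + 1) * (2 * N + n)) ≠ 0 := by
        refine mul_ne_zero hc ?_
        exact_mod_cast (by positivity : 2 * (N + 1) * (2 * N + n) ≠ 0)
      -- The quotient `g` of degree `d` acts on the Laplacian, a nonzero multiple of the next lower
      -- power, and kills it.
      rw [polar_q_mul, show 2 * u + (2 + d) = 2 * (u + 1) + d by ring] at h0
      rw [ih d (by omega) hne (polar_mul_q_one h) (u + 1) (by omega) hg h0, mul_zero]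

/-- Infinitesimal rotations commute with the action on a rotation-invariant form. -/
theorem polar_rotation {M : ℕ} (i j : Fin n) (h : rotation i j (polar a w M 1) = 0) (d e : ℕ)
    (hde : e + d = M) {f : MvPolynomial (Fin n) ℂ} (hf : f.IsHomogeneous d) :
    polar a w e (rotation i j f) = rotation i j (polar a w e f) := by
  induction d generalizing e f with
  | zero =>
    rw [← totalDegree_zero_iff_isHomogeneous, totalDegree_eq_zero_iff_eq_C] at hf
    rw [add_zero] at hde
    rw [hf, rotation_C, polar_zero, polar_C, rotation_mul, rotation_C, hde, h]
    simp
  | succ d ih =>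
    obtain ⟨g, hg, rfl⟩ := exists_eq_sum_X_mul hf
    rw [polar_sum, map_sum, map_sum, polar_sum]
    refine Finset.sum_congr rfl fun l _ => ?_
    have ihl := congrArg (pderiv l) (ih (e + 1) (by omega) (hg l))
    rw [pderiv_polar, ← rotation_pderiv, pderiv_polar, pderiv_polar, pderiv_polar] at ihl
    rw [rotation_mul, polar_add, ihl, rotation_apply i j (X l)]
    classical
    simp only [pderiv_X, Pi.single_apply]
    simp only [eq_comm (a := l)]
    -- The commutator of the rotation with `∂_l` cancels the term coming from the rotation of `X l`.
    by_cases hi : i = l <;> by_cases hj : j = l <;> simp [hi, hj, polar_neg, polar_zero]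

end Polar

/-! ### Dual basis of a tight decomposition -/

theorem polar_one_of_isDecomposition {n m s : ℕ} {a : Fin m → Fin n → ℂ}
    (h : IsDecomposition s a) :
    polar a (fun _ => 1) (2 * s) 1 = C (((2 * s).factorial : ℂ)⁻¹) * q n ^ s := by
  rw [h, Finset.mul_sum, polar]
  refine Finset.sum_congr rfl fun k _ => ?_
  simp

/-- The functional `f ↦ ∑ k, f(a_k)` on forms of degree `2s` is invariant under rotations. -/
theorem sum_eval_rotation {n m s : ℕ} {a : Fin m → Fin n → ℂ} (h : IsDecomposition s a)
    (i j : Fin n) {f : MvPolynomial (Fin n) ℂ} (hf : f.IsHomogeneous (2 * s)) :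
    ∑ k, eval (a k) (rotation i j f) = 0 := by
  have h1 := polar_rotation (a := a) (w := fun _ => 1) i j (M := 2 * s)
    (by rw [polar_one_of_isDecomposition h, rotation_mul, rotation_C, rotation_q_pow]; simp)
    (2 * s) 0 (zero_add _) hf
  rw [polar_zero_right, polar_zero_right, rotation_C] at h1
  simpa using C_injective _ _ (h1.trans C_0.symm)

/-- A form of degree `s` vanishing at all the points of a decomposition of `q_n^s` is zero. -/
theorem eq_zero_of_eval_eq_zero {n m s : ℕ} (hn : 1 ≤ n) {a : Fin m → Fin n → ℂ}
    (h : IsDecomposition s a) {f : MvPolynomial (Fin n) ℂ} (hf : f.IsHomogeneous s)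
    (h0 : ∀ k, eval (a k) f = 0) : f = 0 := by
  refine eq_zero_of_polar_eq_zero hn (inv_ne_zero ?_) (polar_one_of_isDecomposition h) s 0
    (zero_add s) hf ?_
  · exact_mod_cast (2 * s).factorial_ne_zero
  · simp [polar, h0]

theorem exists_eval_eq_single {n m s : ℕ} (hn : 1 ≤ n) {a : Fin m → Fin n → ℂ}
    (h : IsTight s a) :
    ∃ f : Fin m → MvPolynomial (Fin n) ℂ, (∀ k, (f k).IsHomogeneous s) ∧
      ∀ k l, eval (a l) (f k) = (Pi.single k 1 : Fin m → ℂ) l := by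
  let ev : homogeneousSubmodule (Fin n) ℂ s →ₗ[ℂ] (Fin m → ℂ) :=
    LinearMap.pi fun k => (aeval (a k)).toLinearMap ∘ₗ Submodule.subtype _
  have hev : ∀ f k, ev f k = eval (a k) (f : MvPolynomial (Fin n) ℂ) := fun f k => by
    simp [ev, aeval_eq_eval]
  have hinj : Function.Injective ev := by
    rw [injective_iff_map_eq_zero]
    intro f hf
    exact Subtype.ext (eq_zero_of_eval_eq_zero hn h.1 f.2 fun k => by rw [← hev, hf]; rfl)
  have hfr : Module.finrank ℂ (homogeneousSubmodule (Fin n) ℂ s) =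
      Module.finrank ℂ (Fin m → ℂ) := by
    rw [finrank_homogeneousSubmodule, Module.finrank_fin_fun, h.2]
  have : FiniteDimensional ℂ (homogeneousSubmodule (Fin n) ℂ s) :=
    FiniteDimensional.of_injective ev hinj
  choose f hf using (LinearMap.injective_iff_surjective_of_finrank_eq_finrank hfr).mp hinj
  refine ⟨fun k => f (Pi.single k 1), fun k => (f _).2, fun k l => ?_⟩
  rw [← hev, hf]

/-- The values `(a_k · a_k)^s` of a tight decomposition have a common inverse. -/
theorem exists_mul_dotProduct_pow_eq_one {n m s : ℕ} (hn : 1 ≤ n) {a : Fin m → Fin n → ℂ}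
    (h : IsTight s a) : ∃ c : ℂ, ∀ k, c * (a k ⬝ᵥ a k) ^ s = 1 := by
  obtain ⟨f, hf, hfe⟩ := exists_eval_eq_single hn h
  have hrot : ∀ i j, rotation i j (∑ k, f k ^ 2) = 0 := by
    intro i j
    set M : Fin m → Fin m → ℂ := fun k l => eval (a l) (rotation i j (f k)) with hM
    have hexp : ∀ k, rotation i j (f k) = ∑ l, C (M k l) * f l := by
      intro k
      refine sub_eq_zero.mp (eq_zero_of_eval_eq_zero hn h.1 ((rotation_isHomogeneous i j (hf k)).sub
        (IsHomogeneous.sum _ _ _ fun l _ => (hf l).C_mul _)) fun l => ?_)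
      simp [hfe, M, Pi.single_apply]
    -- Invariance of `L` applied to `f k * f l`, whose rotation has `L`-value `M k l + M l k`.
    have hanti : ∀ k l, M k l = - M l k := by
      intro k l
      have h1 := sum_eval_rotation h.1 i j (f := f k * f l)
        (by rw [two_mul]; exact (hf k).mul (hf l))
      simp only [rotation_mul, map_add, map_mul, hfe, Finset.sum_add_distrib, Pi.single_apply] at h1
      simp at h1
      exact eq_neg_of_add_eq_zero_left h1
    have h2 : rotation i j (∑ k, f k ^ 2) = 2 * ∑ k, ∑ l, C (M k l) * (f k * f l) := by
      rw [map_sum, Finset.mul_sum]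
      refine Finset.sum_congr rfl fun k _ => ?_
      rw [sq, rotation_mul, hexp, Finset.mul_sum, Finset.sum_mul, Finset.mul_sum,
        ← Finset.sum_add_distrib]
      exact Finset.sum_congr rfl fun l _ => by ring
    -- An antisymmetric matrix is contracted with the symmetric products `f k * f l`.
    have h3 : ∑ k, ∑ l, C (M k l) * (f k * f l) = -∑ k, ∑ l, C (M k l) * (f k * f l) := by
      conv_lhs => rw [Finset.sum_comm]
      simp only [← Finset.sum_neg_distrib]
      refine Finset.sum_congr rfl fun k _ => Finset.sum_congr rfl fun l _ => ?_
      rw [hanti l k, C_neg]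
      ring
    rw [h2, self_eq_neg.mp h3, mul_zero]
  obtain ⟨c, hc⟩ := exists_eq_C_mul_q_pow hn s (∑ k, f k ^ 2)
    (IsHomogeneous.sum _ _ _ fun k _ => by rw [mul_comm]; exact (hf k).pow 2) hrot
  refine ⟨c, fun k => ?_⟩
  have h1 := congrArg (eval (a k)) hc
  simp only [map_sum, map_pow, map_mul, eval_C, eval_q, hfe, Pi.single_apply] at h1
  simpa using h1.symm

/-- `(2s)!` is the product of the `(2j+1)(2j+2)`, whose even factors cancel. -/
theorem prod_div_eq (n s : ℕ) :
    ((2 * s).factorial : ℂ)⁻¹ * ∏ j ∈ Finset.range s, (2 * (j + 1) * (2 * j + n) : ℂ) =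
      ∏ j ∈ Finset.range s, (2 * (j : ℂ) + (n : ℂ)) / (2 * (j : ℂ) + 1) := by
  induction s with
  | zero => simp
  | succ s ih =>
    rw [Finset.prod_range_succ, Finset.prod_range_succ, ← ih, show 2 * (s + 1) = 2 * s + 1 + 1 by ring,
      Nat.factorial_succ, Nat.factorial_succ]
    have h0 : ((2 * s).factorial : ℂ) ≠ 0 := by exact_mod_cast (2 * s).factorial_ne_zero
    have h1 : (2 * s + 1 : ℂ) ≠ 0 := by exact_mod_cast (2 * s).succ_ne_zero
    have h2 : (s + 1 : ℂ) ≠ 0 := by exact_mod_cast s.succ_ne_zero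
    push_cast
    rw [show (2 * s + 1 + 1 : ℂ) = 2 * (s + 1) by ring]
    field_simp

end TightDecomposition

open TightDecomposition in
theorem mainTheorem2 (n s m : ℕ) (hn : 1 ≤ n) (a : Fin m → Fin n → ℂ)
    (ha : TightDecomposition.IsTight s a) :
    (1 ≤ s → ∀ k, ¬ TightDecomposition.IsIsotropic (a k)) ∧
    TightDecomposition.IsFirstCaliber s a ∧
    ∀ k, (a k ⬝ᵥ a k) ^ s =
      1 / (TightDecomposition.T n s : ℂ) *
        ∏ j ∈ Finset.range s, (2 * (j : ℂ) + (n : ℂ)) / (2 * (j : ℂ) + 1) := by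
  obtain ⟨c, hc⟩ := exists_mul_dotProduct_pow_eq_one hn ha
  have hm : 0 < m := by
    rw [ha.2]
    exact Nat.choose_pos (by omega)
  have hval : ∀ k, (a k ⬝ᵥ a k) ^ s = c⁻¹ := fun k => eq_inv_of_mul_eq_one_right (hc k)
  refine ⟨fun hs k hk => ?_, ⟨ha.1, ?_⟩, fun k => ?_⟩
  · have h := hc k
    rw [show a k ⬝ᵥ a k = 0 from hk, zero_pow (by omega), mul_zero] at h
    exact zero_ne_one h
  · have : Nonempty (Fin m) := ⟨⟨0, hm⟩⟩
    simp only [hval, Set.range_const, Set.ncard_singleton]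
  · have hsum := sum_mul_dotProduct_pow (polar_one_of_isDecomposition ha.1)
    rw [prod_div_eq] at hsum
    have hm0 : (m : ℂ) ≠ 0 := by exact_mod_cast hm.ne'
    rw [← hsum, ← ha.2, hval]
    simp [hval, hm0]
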